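/- Corollary 1.3. Call a triple $(x_1,x_2,x_3)\in\mathbb C^3$ admissible if at most one of its coordinates is zero, and call two triples equivalent if they are equal up to changing the signs of two of the coordinates. Let the braid group $B_3=\langle\beta_1,\beta_2\mid\beta_1\beta_2\beta_1=\beta_2\beta_1\beta_2\rangle$ act on triples by $$\beta_1:(x_1,x_2,x_3)\mapsto(-x_1,\;x_3-x_1x_2,\;x_2),\qquad \beta_2:(x_1,x_2,x_3)\mapsto(x_3,\;-x_2,\;x_1-x_2x_3).$$ This action preserves admissibility, equivalence and the quantity $x_1^2+x_2^2+x_3^2-x_1x_2x_3$. On the set of admissible triples with $x_1^2+x_2^2+x_3^2-x_1x_2x_3\neq4$ it has exactly five finite orbits, and likewise the induced action on the set of equivalence classes of these triples has exactly five finite orbits. In both cases they are the orbits of the triples (respectively, of their classes) $(-2\cos\pi r_1,-2\cos\pi r_2,-2\cos\pi r_3)$ with $$(r_1,r_2,r_3)=\left(\tfrac12,\tfrac13,\tfrac13\right),\ \left(\tfrac12,\tfrac13,\tfrac14\right),\ \left(\tfrac12,\tfrac13,\tfrac15\right),\ \left(\tfrac12,\tfrac13,\tfrac25\right),\ \left(\tfrac12,\tfrac15,\tfrac25\right).$$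 The lengths of these orbits, that is, the numbers of equivalence classes of triples they contain, are $4$, $9$, $10$, $10$ and $18$, respectively. -/

import Mathlib

namespace BraidTriples

/-- The defining relation `β₁β₂β₁ = β₂β₁β₂` of the braid group on three strings; the generators
`β₁`, `β₂` are indexed by `0`, `1`. -/
def braidRels : Set (FreeGroup (Fin 2)) :=
  {FreeGroup.of 0 * FreeGroup.of 1 * FreeGroup.of 0 *
    (FreeGroup.of 1 * FreeGroup.of 0 * FreeGroup.of 1)⁻¹}

/-- The braid group `B₃` on three strings, by its standard presentation. -/
abbrev B₃ : Type := PresentedGroup braidRels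

/-- Triples of complex numbers. -/
@[ext]
structure Triple where
  x₁ : ℂ
  x₂ : ℂ
  x₃ : ℂ

/-- `β₁ : (x₁, x₂, x₃) ↦ (-x₁, x₃ - x₁x₂, x₂)`, a bijection of the set of triples. -/
def beta₁ : Equiv.Perm Triple where
  toFun t := ⟨-t.x₁, t.x₃ - t.x₁ * t.x₂, t.x₂⟩
  invFun t := ⟨-t.x₁, t.x₃, t.x₂ - t.x₁ * t.x₃⟩
  left_inv t := by ext <;> simp
  right_inv t := by ext <;> simp

/-- `β₂ : (x₁, x₂, x₃) ↦ (x₃, -x₂, x₁ - x₂x₃)`, a bijection of the set of triples. -/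
def beta₂ : Equiv.Perm Triple where
  toFun t := ⟨t.x₃, -t.x₂, t.x₁ - t.x₂ * t.x₃⟩
  invFun t := ⟨t.x₃ - t.x₁ * t.x₂, -t.x₂, t.x₁⟩
  left_inv t := by
    ext
    · simp; ring
    · simp
    · simp
  right_inv t := by
    ext
    · simp
    · simp
    · simp; ring

theorem beta_braid : beta₁ * beta₂ * beta₁ = beta₂ * beta₁ * beta₂ := by
  ext t <;> simp [beta₁, beta₂] <;> ring

/-- The permutation representation of `B₃` on triples given by `β₁`, `β₂`. -/
def braidHom : B₃ →* Equiv.Perm Triple :=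
  PresentedGroup.toGroup (f := ![beta₁, beta₂]) (by
    intro r hr
    rw [Set.mem_singleton_iff.mp hr]
    simp only [map_mul, map_inv, FreeGroup.lift_apply_of, Matrix.cons_val_zero,
      Matrix.cons_val_one]
    rw [beta_braid, mul_inv_cancel])

/-- The braid action on triples. -/
instance : MulAction B₃ Triple := MulAction.compHom Triple braidHom

theorem smul_def (g : B₃) (t : Triple) : g • t = braidHom g t := rfl

theorem of_zero_smul (t : Triple) :
    (PresentedGroup.of 0 : B₃) • t = ⟨-t.x₁, t.x₃ - t.x₁ * t.x₂, t.x₂⟩ := by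
  rw [smul_def, braidHom, PresentedGroup.toGroup.of]; rfl

theorem of_one_smul (t : Triple) :
    (PresentedGroup.of 1 : B₃) • t = ⟨t.x₃, -t.x₂, t.x₁ - t.x₂ * t.x₃⟩ := by
  rw [smul_def, braidHom, PresentedGroup.toGroup.of]; rfl

/-- A triple is admissible if at most one of its coordinates is zero. -/
def Triple.Admissible (t : Triple) : Prop :=
  (t.x₁ ≠ 0 ∨ t.x₂ ≠ 0) ∧ (t.x₁ ≠ 0 ∨ t.x₃ ≠ 0) ∧ (t.x₂ ≠ 0 ∨ t.x₃ ≠ 0)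

/-- The condition `x₁² + x₂² + x₃² - x₁x₂x₃ ≠ 4`. -/
def Triple.NonFlat (t : Triple) : Prop :=
  t.x₁ ^ 2 + t.x₂ ^ 2 + t.x₃ ^ 2 - t.x₁ * t.x₂ * t.x₃ ≠ 4

/-- Two triples are equivalent if they are equal up to the change of sign of two coordinates. -/
def Triple.Equivalent (s t : Triple) : Prop :=
  s = t ∨ s = ⟨-t.x₁, -t.x₂, t.x₃⟩ ∨ s = ⟨-t.x₁, t.x₂, -t.x₃⟩ ∨ s = ⟨t.x₁, -t.x₂, -t.x₃⟩

/-- A property that both generators preserve and reflect is invariant under `B₃`. -/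
theorem smul_iff {p : Triple → Prop} (h₁ : ∀ t, p (beta₁ t) ↔ p t) (h₂ : ∀ t, p (beta₂ t) ↔ p t)
    (g : B₃) : ∀ t, p (g • t) ↔ p t := by
  obtain ⟨w, rfl⟩ := PresentedGroup.mk_surjective _ g
  induction w using FreeGroup.induction_on with
  | C1 => intro t; rw [map_one, one_smul]
  | of i =>
    intro t
    fin_cases i
    · exact (Iff.of_eq (congrArg p (of_zero_smul t))).trans (h₁ t)
    · exact (Iff.of_eq (congrArg p (of_one_smul t))).trans (h₂ t)
  | inv_of i ih =>
    intro t
    rw [← ih, map_inv, smul_inv_smul]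
  | mul x y hx hy => intro t; rw [map_mul, mul_smul, hx, hy]

theorem admissible_smul_iff (g : B₃) (t : Triple) : (g • t).Admissible ↔ t.Admissible := by
  refine smul_iff (fun t => ?_) (fun t => ?_) g t
  · simp only [Triple.Admissible, beta₁, Equiv.coe_fn_mk]
    by_cases h₁ : t.x₁ = 0 <;> by_cases h₂ : t.x₂ = 0 <;> simp [h₁, h₂]
  · simp only [Triple.Admissible, beta₂, Equiv.coe_fn_mk]
    by_cases h₂ : t.x₂ = 0 <;> by_cases h₃ : t.x₃ = 0 <;> simp [h₂, h₃]

theorem nonFlat_smul_iff (g : B₃) (t : Triple) : (g • t).NonFlat ↔ t.NonFlat := by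
  refine smul_iff (fun t => ?_) (fun t => ?_) g t
  · simp only [Triple.NonFlat, beta₁, Equiv.coe_fn_mk]
    ring_nf
  · simp only [Triple.NonFlat, beta₂, Equiv.coe_fn_mk]
    ring_nf

/-- The space of admissible triples with `x₁² + x₂² + x₃² - x₁x₂x₃ ≠ 4`, as a set stable under
the braid action. -/
def admissibleNonFlat : SubMulAction B₃ Triple where
  carrier := {t | t.Admissible ∧ t.NonFlat}
  smul_mem' g _ ht := ⟨(admissible_smul_iff g _).2 ht.1, (nonFlat_smul_iff g _).2 ht.2⟩

theorem Triple.equivalent_equivalence : Equivalence Triple.Equivalent where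
  refl _ := Or.inl rfl
  symm := by
    rintro s t (rfl | rfl | rfl | rfl) <;> simp [Triple.Equivalent]
  trans := by
    rintro s t u (rfl | rfl | rfl | rfl) (rfl | rfl | rfl | rfl) <;> simp [Triple.Equivalent]

theorem Triple.Equivalent.smul (g : B₃) :
    ∀ {s t : Triple}, s.Equivalent t → (g • s).Equivalent (g • t) := by
  obtain ⟨w, rfl⟩ := PresentedGroup.mk_surjective _ g
  induction w using FreeGroup.induction_on with
  | C1 => intro s t h; simpa using h
  | of i =>
    intro s t h
    fin_cases i
    · change ((PresentedGroup.of 0 : B₃) • s).Equivalent ((PresentedGroup.of 0 : B₃) • t)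
      rw [of_zero_smul, of_zero_smul]
      rcases h with rfl | rfl | rfl | rfl <;> simp [Triple.Equivalent] <;> grind
    · change ((PresentedGroup.of 1 : B₃) • s).Equivalent ((PresentedGroup.of 1 : B₃) • t)
      rw [of_one_smul, of_one_smul]
      rcases h with rfl | rfl | rfl | rfl <;> simp [Triple.Equivalent] <;> grind
  | inv_of i ih =>
    intro s t h
    have key : ∀ u : Triple, (PresentedGroup.mk braidRels (FreeGroup.of i)⁻¹ : B₃) • u =
        (PresentedGroup.of i : B₃)⁻¹ • u := fun u => by rw [map_inv]; rfl
    rw [key, key]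
    fin_cases i
    · change (beta₁.symm s).Equivalent (beta₁.symm t)
      rcases h with rfl | rfl | rfl | rfl <;> simp [Triple.Equivalent, beta₁] <;> grind
    · change (beta₂.symm s).Equivalent (beta₂.symm t)
      rcases h with rfl | rfl | rfl | rfl <;> simp [Triple.Equivalent, beta₂] <;> grind
  | mul x y hx hy => intro s t h; rw [map_mul, mul_smul, mul_smul]; exact hx (hy h)

/-- Equivalence of triples, on the space of admissible triples with
`x₁² + x₂² + x₃² - x₁x₂x₃ ≠ 4`. -/
instance equivalentSetoid : Setoid admissibleNonFlat where
  r s t := (s : Triple).Equivalent t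
  iseqv := Triple.equivalent_equivalence.comap (fun s : admissibleNonFlat => (s : Triple))

/-- Equivalence classes of admissible triples with `x₁² + x₂² + x₃² - x₁x₂x₃ ≠ 4`. -/
abbrev TripleClass : Type := Quotient equivalentSetoid

/-- The braid action on equivalence classes. -/
instance : MulAction B₃ TripleClass where
  smul g := Quotient.map (g • ·) fun _ _ h => Triple.Equivalent.smul g h
  one_smul c := by
    induction c using Quotient.inductionOn with
    | h t => exact congrArg (Quotient.mk _) (one_smul B₃ t)
  mul_smul g h c := by
    induction c using Quotient.inductionOn with
    | h t => exact congrArg (Quotient.mk _) (mul_smul g h t)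

/-- The set of finite orbits of an action. -/
def finiteOrbits (G X : Type) [Group G] [MulAction G X] : Set (Set X) :=
  {O | O.Finite ∧ ∃ x : X, O = MulAction.orbit G x}

/-- The triple `(-2 cos πr₁, -2 cos πr₂, -2 cos πr₃)`. -/
noncomputable def cosTriple (r₁ r₂ r₃ : ℚ) : Triple :=
  ⟨-2 * Complex.cos (Real.pi * r₁), -2 * Complex.cos (Real.pi * r₂),
    -2 * Complex.cos (Real.pi * r₃)⟩

/-- The representatives of the five orbits. -/
noncomputable def representative : Fin 5 → Triple :=
  ![cosTriple (1 / 2) (1 / 3) (1 / 3),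
    cosTriple (1 / 2) (1 / 3) (1 / 4),
    cosTriple (1 / 2) (1 / 3) (1 / 5),
    cosTriple (1 / 2) (1 / 3) (2 / 5),
    cosTriple (1 / 2) (1 / 5) (2 / 5)]

end BraidTriples

namespace BraidTriples

/-! Up to sign changes the braid group contains the cyclic shift and the Vieta move `(x, y, z) ↦ (x,
xy - z, y)`, so a finite orbit of classes gives a finite set of triples stable under both. For fixed
`x = μ + μ⁻¹` the Vieta move is linear in `(y, z)` with eigenvalues `μ` and `μ⁻¹`. Finiteness and
admissibility make `μ` a root of unity, and `μ = ±1` is possible only where `ω = x² + y² + z² - xyz`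
equals `4`. Hence all coordinates are real and lie in `(-2, 2)` (`exists_real`), and an extremal
argument then gives `ω < 4` (`lt_four`). The hypotheses survive field homomorphisms, so all this
holds for every conjugate too.

Therefore `4 - x² = (4 - ω) + (ω - x²)` is a sum of two totally positive algebraic integers, and in
a field of degree `d` its norm is at least `2 ^ d` (`two_pow_le_of_totallyPositive`). But `4 - x² =
2 - ζ - ζ⁻¹` with `ζ = μ²` of some order `q`, and its power `q - 1` divides `q²`
(`exists_pow_mul_eq_sq`). So `2 ^ (q - 1) ≤ q²`, whence `q ≤ 6`, and `q = 6` drops out because `4 -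
x²` would be the unit `1`.

This leaves nine possible coordinates (`sq_eq`), all in `ℤ[√2, φ]`. A finite exact computation shows
that the triples which keep such coordinates fill the five orbits (`exists_mem_orbitList`). -/

/-! ### Stable finite sets of triples and their transport along field homomorphisms -/

/-- A finite set of triples over a field, stable under cyclic shifts and Vieta moves, all of whose
members are admissible and satisfy `x² + y² + z² - xyz ≠ 4`. -/
structure FiniteStable {F : Type*} [Field F] (T : Set (F × F × F)) : Prop where
  finite : T.Finite
  shift : ∀ {x y z : F}, (x, y, z) ∈ T → (z, x, y) ∈ T
  vieta : ∀ {x y z : F}, (x, y, z) ∈ T → (x, x * y - z, y) ∈ T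
  vieta_inv : ∀ {x y z : F}, (x, y, z) ∈ T → (x, z, x * z - y) ∈ T
  admissible : ∀ {x y z : F}, (x, y, z) ∈ T → y ≠ 0 ∨ z ≠ 0
  nonFlat : ∀ {x y z : F}, (x, y, z) ∈ T → x ^ 2 + y ^ 2 + z ^ 2 - x * y * z ≠ 4

/-- The map induced on triples by a map of coordinates. -/
def mapTriple {F E : Type*} (f : F → E) (t : F × F × F) : E × E × E := (f t.1, f t.2.1, f t.2.2)

theorem mapTriple_injective {F E : Type*} {f : F → E} (hf : Function.Injective f) :
    Function.Injective (mapTriple f) := by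
  rintro ⟨x, y, z⟩ ⟨x', y', z'⟩ h
  simp only [mapTriple, Prod.mk.injEq] at h
  rw [hf h.1, hf h.2.1, hf h.2.2]

namespace FiniteStable

/-- Restricting to a number field and then applying `image` to each embedding into `ℂ` yields the
Galois conjugates of a stable set. -/
theorem preimage {F E : Type*} [Field F] [Field E] {T : Set (E × E × E)} (hT : FiniteStable T)
    (f : F →+* E) : FiniteStable (mapTriple f ⁻¹' T) where
  finite := hT.finite.preimage (mapTriple_injective f.injective).injOn
  shift h := hT.shift h
  vieta h := by simpa [mapTriple] using hT.vieta h
  vieta_inv h := by simpa [mapTriple] using hT.vieta_inv h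
  admissible h := by simpa [mapTriple] using hT.admissible h
  nonFlat {x y z} h h4 := hT.nonFlat h (by simpa [map_ofNat] using congrArg f h4)

theorem image {F E : Type*} [Field F] [Field E] {T : Set (F × F × F)} (hT : FiniteStable T)
    (f : F →+* E) : FiniteStable (mapTriple f '' T) where
  finite := hT.finite.image _
  shift := by
    rintro _ _ _ ⟨⟨x, y, z⟩, h, h'⟩
    cases h'
    exact ⟨_, hT.shift h, rfl⟩
  vieta := by
    rintro _ _ _ ⟨⟨x, y, z⟩, h, h'⟩
    cases h'
    exact ⟨_, hT.vieta h, by simp [mapTriple]⟩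
  vieta_inv := by
    rintro _ _ _ ⟨⟨x, y, z⟩, h, h'⟩
    cases h'
    exact ⟨_, hT.vieta_inv h, by simp [mapTriple]⟩
  admissible := by
    rintro _ _ _ ⟨⟨x, y, z⟩, h, h'⟩
    cases h'
    simpa using hT.admissible h
  nonFlat := by
    rintro _ _ _ ⟨⟨x, y, z⟩, h, h'⟩ h4
    cases h'
    exact hT.nonFlat h (f.injective (by simpa [map_ofNat] using h4))

/-! ### Dynamics of the Vieta move: coordinates come from roots of unity -/

/-- The Vieta move on the last two coordinates. -/
def vietaMap {F : Type*} [Field F] (t : F × F × F) : F × F × F := (t.1, t.1 * t.2.1 - t.2.2, t.2.1)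

section
variable {F : Type*} [Field F] {T : Set (F × F × F)}

theorem iterate_mem (hT : FiniteStable T) {t : F × F × F} (ht : t ∈ T) (n : ℕ) :
    vietaMap^[n] t ∈ T := by
  induction n with
  | zero => exact ht
  | succ n ih => rw [Function.iterate_succ_apply']; exact hT.vieta ih

theorem iterate_fst (t : F × F × F) (n : ℕ) : (vietaMap^[n] t).1 = t.1 := by
  induction n with
  | zero => rfl
  | succ n ih => rw [Function.iterate_succ_apply']; exact ih

/-- `y - z / μ` is an eigenfunction of the Vieta move for the eigenvalue `μ`, if `x = μ + μ⁻¹`. -/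
theorem iterate_eigen {μ : F} (hμ : μ ≠ 0) {t : F × F × F} (hx : t.1 = μ + μ⁻¹) (n : ℕ) :
    (vietaMap^[n] t).2.1 - μ⁻¹ * (vietaMap^[n] t).2.2 = μ ^ n * (t.2.1 - μ⁻¹ * t.2.2) := by
  induction n with
  | zero => simp
  | succ n ih =>
    rw [pow_succ', mul_assoc, ← ih, Function.iterate_succ_apply']
    simp only [vietaMap, iterate_fst, hx]
    field_simp
    ring

theorem iterate_unipotent {μ : F} (hμ : μ ^ 2 = 1) {t : F × F × F} (hx : t.1 = 2 * μ) (n : ℕ) :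
    μ ^ n * (vietaMap^[n] t).2.1 = t.2.1 + n * (t.2.1 - μ * t.2.2) := by
  have hμ0 : μ ≠ 0 := by rintro rfl; simp at hμ
  have hinv : μ⁻¹ = μ := by field_simp; exact hμ.symm
  induction n with
  | zero => simp
  | succ n ih =>
    have h := iterate_eigen hμ0 (t := t) (by rw [hx, hinv]; ring) n
    rw [hinv] at h
    have hn : μ ^ n * μ ^ n = 1 := by rw [← pow_add, ← two_mul, pow_mul, hμ, one_pow]
    rw [Function.iterate_succ_apply']
    simp only [vietaMap, iterate_fst, hx]
    push_cast
    linear_combination ih + μ ^ n * h + (t.2.1 - μ * t.2.2) * hn +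
      2 * μ ^ n * (vietaMap^[n] t).2.1 * hμ

theorem exists_iterate_eq (hT : FiniteStable T) {t : F × F × F} (ht : t ∈ T) :
    ∃ i j : ℕ, i < j ∧ vietaMap^[i] t = vietaMap^[j] t :=
  hT.finite.exists_lt_map_eq_of_forall_mem (iterate_mem hT ht)

theorem pow_eq_one_of_pow_eq {μ : F} (hμ : μ ≠ 0) {i j : ℕ} (hij : i < j) (h : μ ^ i = μ ^ j) :
    ∃ n, 0 < n ∧ μ ^ n = 1 := by
  refine ⟨j - i, by omega, ?_⟩
  rw [pow_sub₀ _ hμ hij.le, ← h, mul_inv_cancel₀ (pow_ne_zero _ hμ)]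

/-- For `μ = ±1` the linear map is `μ` times a unipotent one, so an orbit grows linearly unless `y =
μ z`, and in that case the invariant equals `4`. -/
theorem sq_ne_one [CharZero F] (hT : FiniteStable T) {x y z μ : F} (ht : (x, y, z) ∈ T)
    (hμ : μ ≠ 0) (hx : x = μ + μ⁻¹) : μ ^ 2 ≠ 1 := by
  intro h
  have hinv : μ⁻¹ = μ := by field_simp; exact h.symm
  have hx2 : x = 2 * μ := by rw [hx, hinv]; ring
  obtain ⟨i, j, hij, he⟩ := hT.exists_iterate_eq ht
  have hf : y - μ * z ≠ 0 := by
    intro h0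
    apply hT.nonFlat ht
    rw [hx2, sub_eq_zero.1 h0]
    linear_combination (4 - z ^ 2) * h
  have h1 := iterate_eigen hμ (t := (x, y, z)) hx i
  have h2 := iterate_eigen hμ (t := (x, y, z)) hx j
  have h3 := iterate_unipotent h (t := (x, y, z)) hx2 i
  have h4 := iterate_unipotent h (t := (x, y, z)) hx2 j
  rw [he, h2, hinv] at h1
  have hp : μ ^ j = μ ^ i := mul_right_cancel₀ hf h1
  rw [he, ← hp, h4] at h3
  have : (j : F) = i := mul_right_cancel₀ hf (add_left_cancel h3)
  exact hij.ne' (by exact_mod_cast this)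

/-- The eigenfunctions for `μ` and `μ⁻¹` are independent, so by admissibility one of them is nonzero
at `(y, z)`. Two equal iterates then give two equal powers of its eigenvalue. -/
theorem exists_pow_eq_one [CharZero F] (hT : FiniteStable T) {x y z μ : F} (ht : (x, y, z) ∈ T)
    (hμ : μ ≠ 0) (hx : x = μ + μ⁻¹) : ∃ n, 0 < n ∧ μ ^ n = 1 := by
  have hsq := hT.sq_ne_one ht hμ hx
  obtain ⟨i, j, hij, he⟩ := hT.exists_iterate_eq ht
  have h1 := iterate_eigen hμ (t := (x, y, z)) hx i
  have h2 := iterate_eigen hμ (t := (x, y, z)) hx j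
  have h3 := iterate_eigen (inv_ne_zero hμ) (t := (x, y, z)) (by rw [inv_inv, add_comm]; exact hx) i
  have h4 := iterate_eigen (inv_ne_zero hμ) (t := (x, y, z)) (by rw [inv_inv, add_comm]; exact hx) j
  rw [he, h2] at h1
  rw [he, h4] at h3
  by_cases hf : y - μ⁻¹ * z = 0
  · have hg : y - μ⁻¹⁻¹ * z ≠ 0 := by
      intro hg
      rw [inv_inv] at hg
      have hz : (μ - μ⁻¹) * z = 0 := by linear_combination hf - hg
      have hne : μ - μ⁻¹ ≠ 0 := fun h0 => hsq (by field_simp at h0; linear_combination h0)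
      have hz0 : z = 0 := (mul_eq_zero.1 hz).resolve_left hne
      have hy0 : y = 0 := by simpa [hz0] using hf
      exact (hT.admissible ht).elim (· hy0) (· hz0)
    obtain ⟨n, hn, h⟩ := pow_eq_one_of_pow_eq (inv_ne_zero hμ) hij (mul_right_cancel₀ hg h3).symm
    exact ⟨n, hn, by simpa using h⟩
  · exact pow_eq_one_of_pow_eq hμ hij (mul_right_cancel₀ hf h1).symm

end

theorem _root_.BraidTriples.exists_eq_add_inv (x : ℂ) : ∃ μ : ℂ, μ ≠ 0 ∧ x = μ + μ⁻¹ := by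
  obtain ⟨s, hs⟩ := IsAlgClosed.exists_pow_nat_eq (x ^ 2 - 4) (n := 2) (by norm_num)
  have hne : (x + s) / 2 ≠ 0 := by
    intro h
    have h' : s = -x := by linear_combination 2 * h
    rw [h'] at hs
    have : (4 : ℂ) = 0 := by linear_combination hs
    norm_num at this
  refine ⟨(x + s) / 2, hne, ?_⟩
  have : x + s ≠ 0 := fun h => hne (by rw [h, zero_div])
  field_simp
  linear_combination -hs

/-- Every coordinate is `μ + μ⁻¹` for a root of unity `μ ≠ ±1`. -/
theorem exists_root_of_unity {T : Set (ℂ × ℂ × ℂ)} (hT : FiniteStable T) {x y z : ℂ}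
    (ht : (x, y, z) ∈ T) :
    ∃ μ : ℂ, x = μ + μ⁻¹ ∧ μ ^ 2 ≠ 1 ∧ ∃ n, 0 < n ∧ μ ^ n = 1 := by
  obtain ⟨μ, hμ, hx⟩ := exists_eq_add_inv x
  exact ⟨μ, hx, hT.sq_ne_one ht hμ hx, hT.exists_pow_eq_one ht hμ hx⟩

theorem exists_real {T : Set (ℂ × ℂ × ℂ)} (hT : FiniteStable T) {x y z : ℂ}
    (ht : (x, y, z) ∈ T) : ∃ r : ℝ, x = r ∧ |r| < 2 := by
  obtain ⟨μ, hx, hsq, n, hn, hμn⟩ := hT.exists_root_of_unity ht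
  have hnorm : ‖μ‖ = 1 := Complex.norm_eq_one_of_pow_eq_one hμn hn.ne'
  have hμ : μ ≠ 0 := by rintro rfl; simp at hnorm
  have hxr : x = (2 * μ.re : ℝ) := by
    rw [hx, Complex.inv_eq_conj hnorm, Complex.add_conj]
  refine ⟨2 * μ.re, hxr, lt_of_le_of_ne ?_ ?_⟩
  · rw [abs_mul, abs_two]
    linarith [Complex.abs_re_le_norm μ]
  · intro h2
    have h4 : x ^ 2 = 4 := by
      rw [hxr, ← Complex.ofReal_pow, ← sq_abs, h2]; norm_num
    apply hsq
    -- `(μ² - 1)² = μ² (x² - 4)`.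
    have h0 : (μ ^ 2 - 1) ^ 2 = 0 := by
      rw [hx] at h4
      field_simp at h4
      linear_combination h4
    exact sub_eq_zero.1 (pow_eq_zero_iff (two_ne_zero) |>.1 h0)

/-! ### The upper bound for the invariant -/

/-- If all coordinates of all triples lie in `(-2, 2)`, then `x² + y² + z² - xyz < 4`. -/
theorem lt_four {T : Set (ℝ × ℝ × ℝ)} (hT : FiniteStable T)
    (hlt : ∀ {x y z : ℝ}, (x, y, z) ∈ T → |x| < 2) {x y z : ℝ} (ht : (x, y, z) ∈ T) :
    x ^ 2 + y ^ 2 + z ^ 2 - x * y * z < 4 := by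
  by_contra hcon
  have hgt : 4 < x ^ 2 + y ^ 2 + z ^ 2 - x * y * z :=
    lt_of_le_of_ne (not_lt.1 hcon) (hT.nonFlat ht).symm
  obtain ⟨ω, hω⟩ : ∃ ω, ω = x ^ 2 + y ^ 2 + z ^ 2 - x * y * z := ⟨_, rfl⟩
  rw [← hω] at hgt
  -- Within one level set of the invariant, maximise `|x|` first and then `|y|` for that `x`.
  set U : Set (ℝ × ℝ × ℝ) :=
    {t ∈ T | t.1 ^ 2 + t.2.1 ^ 2 + t.2.2 ^ 2 - t.1 * t.2.1 * t.2.2 = ω} with hU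
  have hUfin : U.Finite := hT.finite.subset fun _ h => h.1
  obtain ⟨⟨a, b₀, c₀⟩, haU, hamax⟩ := Set.exists_max_image U (fun t => |t.1|) hUfin
    ⟨(x, y, z), ht, hω.symm⟩
  obtain ⟨⟨a', b, c⟩, ⟨hbU, hba⟩, hbmax⟩ := Set.exists_max_image {t ∈ U | t.1 = a}
    (fun t => |t.2.1|) (hUfin.subset fun _ h => h.1) ⟨(a, b₀, c₀), haU, rfl⟩
  obtain rfl : a' = a := hba
  obtain ⟨hbT, hbω⟩ := hbU
  simp only at hbω
  have hb_le : |b| ≤ |a'| := hamax (b, c, a')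
    ⟨hT.shift (hT.shift hbT), by simp only; linear_combination hbω⟩
  have hc_le : |c| ≤ |b| := hbmax (a', c, a' * c - b)
    ⟨⟨hT.vieta_inv hbT, by simp only; linear_combination hbω⟩, rfl⟩
  have hc'_le : |a' * b - c| ≤ |b| := hbmax (a', a' * b - c, b)
    ⟨⟨hT.vieta hbT, by simp only; linear_combination hbω⟩, rfl⟩
  have ha2 : |a'| < 2 := hlt hbT
  -- `c` and `a'b - c` are the roots of `t² - a'b t + (a'² + b² - ω)`. Both lie in `[-|b|, |b|]`, so
  -- this polynomial is nonnegative at the endpoint `±|b|` with the sign of `a'b`.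
  have key : 0 ≤ b ^ 2 - |a'| * b ^ 2 + (a' ^ 2 + b ^ 2 - ω) := by
    have h1 := abs_le.1 hc_le
    have h2 := abs_le.1 hc'_le
    have hb2 : |b| ^ 2 = b ^ 2 := sq_abs b
    rcases le_total 0 (a' * b) with h | h
    · have h3 : |a'| * |b| = a' * b := by rw [← abs_mul, abs_of_nonneg h]
      have := mul_nonneg (sub_nonneg.2 h1.2) (sub_nonneg.2 h2.2)
      linear_combination this + (1 - |a'|) * hb2 - hbω + |b| * h3
    · have h3 : |a'| * |b| = -(a' * b) := by rw [← abs_mul, abs_of_nonpos h]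
      have := mul_nonneg (neg_le_iff_add_nonneg.1 h1.1) (neg_le_iff_add_nonneg.1 h2.1)
      linear_combination this + (1 - |a'|) * hb2 - hbω + |b| * h3
  have hb2 : b ^ 2 ≤ a' ^ 2 := sq_le_sq.2 hb_le
  have ha : |a'| ^ 2 = a' ^ 2 := sq_abs a'
  -- With `b² ≤ a'²`, `key` gives `ω ≤ 3a'² - |a'|³`, and this product is `4 - 3a'² + |a'|³`.
  have hs : 0 ≤ (2 - |a'|) ^ 2 * (|a'| + 1) := by positivity
  nlinarith [mul_nonneg (sub_nonneg.2 ha2.le) (sub_nonneg.2 hb2)]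

theorem lt_four_of_complex {T : Set (ℂ × ℂ × ℂ)} (hT : FiniteStable T) {x y z : ℝ}
    (ht : ((x : ℂ), (y : ℂ), (z : ℂ)) ∈ T) : x ^ 2 + y ^ 2 + z ^ 2 - x * y * z < 4 := by
  refine (hT.preimage Complex.ofRealHom).lt_four (fun {x y z} h => ?_) ht
  obtain ⟨r, hr, h2⟩ := hT.exists_real h
  have hr' : x = r := Complex.ofReal_injective hr
  rwa [hr']

end FiniteStable

/-! ### Norms of totally positive algebraic integers -/

section Norm

variable {L : Type*} [Field L] [Algebra ℚ L] [FiniteDimensional ℚ L]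

/-- The product is the field norm, which is a nonzero rational integer. -/
theorem one_le_norm_prod_embeddings {a : L} (ha : IsIntegral ℤ a) (h0 : a ≠ 0) :
    1 ≤ ‖∏ σ : L →ₐ[ℚ] ℂ, σ a‖ := by
  obtain ⟨n, hn⟩ := IsIntegrallyClosed.isIntegral_iff.1 (Algebra.isIntegral_norm ℚ ha)
  have hn0 : n ≠ 0 := by
    rintro rfl
    exact h0 (Algebra.norm_eq_zero_iff.1 (by rw [← hn, map_zero]))
  rw [← Algebra.norm_eq_prod_embeddings ℚ ℂ a, ← hn]
  simp only [algebraMap_int_eq, eq_intCast, eq_ratCast, Rat.cast_intCast, Complex.norm_intCast]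
  exact_mod_cast Int.one_le_abs hn0

/-- If `a` and `b` are nonzero totally positive algebraic integers, and `(a + b) ^ m` divides the
positive integer `c`, then `2 ^ m ≤ c`. -/
theorem two_pow_le_of_totallyPositive {a b w : L} {m c : ℕ} (ha : IsIntegral ℤ a)
    (hb : IsIntegral ℤ b) (hw : IsIntegral ℤ w) (ha0 : ∀ σ : L →ₐ[ℚ] ℂ, ∃ r : ℝ, 0 < r ∧ σ a = r)
    (hb0 : ∀ σ : L →ₐ[ℚ] ℂ, ∃ r : ℝ, 0 < r ∧ σ b = r) (hc : c ≠ 0) (h : (a + b) ^ m * w = c) :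
    2 ^ m ≤ c := by
  choose r hr hra using ha0
  choose s hs hsb using hb0
  let σ₀ : L →ₐ[ℚ] ℂ := IsAlgClosed.lift
  have : Nonempty (L →ₐ[ℚ] ℂ) := ⟨σ₀⟩
  have := Algebra.charZero_of_charZero ℚ L
  have ha' : a ≠ 0 := by
    rintro rfl
    have h1 := hra σ₀
    rw [map_zero] at h1
    exact (hr σ₀).ne (by exact_mod_cast h1)
  have hb' : b ≠ 0 := by
    rintro rfl
    have h1 := hsb σ₀
    rw [map_zero] at h1
    exact (hs σ₀).ne (by exact_mod_cast h1)
  have hw' : w ≠ 0 := by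
    rintro rfl
    rw [mul_zero] at h
    exact hc (by exact_mod_cast h.symm)
  have hA : 1 ≤ ∏ σ, r σ := by
    have := one_le_norm_prod_embeddings ha ha'
    simp only [hra, ← Complex.ofReal_prod, Complex.norm_real, Real.norm_eq_abs] at this
    rwa [abs_of_pos (Finset.prod_pos fun σ _ => hr σ)] at this
  have hB : 1 ≤ ∏ σ, s σ := by
    have := one_le_norm_prod_embeddings hb hb'
    simp only [hsb, ← Complex.ofReal_prod, Complex.norm_real, Real.norm_eq_abs] at this
    rwa [abs_of_pos (Finset.prod_pos fun σ _ => hs σ)] at this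
  set d := Fintype.card (L →ₐ[ℚ] ℂ) with hd
  have hd0 : d ≠ 0 := Fintype.card_ne_zero
  -- Arithmetic-geometric mean at each embedding, `4rs ≤ (r + s)²`, multiplied over all embeddings.
  have hU : (2 : ℝ) ^ d ≤ ∏ σ, (r σ + s σ) := by
    refine (pow_le_pow_iff_left₀ (by positivity)
      (Finset.prod_nonneg fun σ _ => (add_pos (hr σ) (hs σ)).le) two_ne_zero).1 ?_
    calc ((2 : ℝ) ^ d) ^ 2 = 4 ^ d := by rw [← pow_mul, mul_comm, pow_mul]; norm_num
      _ ≤ 4 ^ d * ((∏ σ, r σ) * ∏ σ, s σ) :=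
        le_mul_of_one_le_right (by positivity) (one_le_mul_of_one_le_of_one_le hA hB)
      _ = ∏ σ, 4 * (r σ * s σ) := by
        rw [Finset.prod_mul_distrib, Finset.prod_mul_distrib, Finset.prod_const, Finset.card_univ]
      _ ≤ ∏ σ, (r σ + s σ) ^ 2 := by
        refine Finset.prod_le_prod (fun σ _ => by have := hr σ; have := hs σ; positivity) ?_
        intro σ _
        nlinarith [sq_nonneg (r σ - s σ)]
      _ = (∏ σ, (r σ + s σ)) ^ 2 := Finset.prod_pow _ _ _
  have hW := one_le_norm_prod_embeddings hw hw'
  have hprod : (∏ σ, (r σ + s σ)) ^ m * ‖∏ σ : L →ₐ[ℚ] ℂ, σ w‖ = (c : ℝ) ^ d := by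
    have h1 : ∀ σ : L →ₐ[ℚ] ℂ, ((r σ + s σ : ℝ) : ℂ) ^ m * σ w = c := fun σ => by
      rw [Complex.ofReal_add, ← hra, ← hsb, ← map_add, ← map_pow, ← map_mul, h, map_natCast]
    have h2 : (∏ σ : L →ₐ[ℚ] ℂ, ((r σ + s σ : ℝ) : ℂ)) ^ m * ∏ σ : L →ₐ[ℚ] ℂ, σ w = (c : ℂ) ^ d := by
      rw [← Finset.prod_pow, ← Finset.prod_mul_distrib, Finset.prod_congr rfl fun σ _ => h1 σ,
        Finset.prod_const, Finset.card_univ]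
    have h3 := congrArg norm h2
    rw [norm_mul, norm_pow, norm_pow, Complex.norm_natCast, ← Complex.ofReal_prod,
      Complex.norm_real, Real.norm_eq_abs,
      abs_of_pos (Finset.prod_pos fun σ _ => add_pos (hr σ) (hs σ))] at h3
    exact h3
  have hfin : ((2 : ℝ) ^ m) ^ d ≤ (c : ℝ) ^ d := by
    rw [← hprod, ← pow_mul, mul_comm, pow_mul]
    exact (pow_le_pow_left₀ (by positivity) hU m).trans
      (le_mul_of_one_le_right (pow_nonneg ((by positivity : (0 : ℝ) ≤ 2 ^ d).trans hU) m) hW)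
  exact_mod_cast le_of_pow_le_pow_left₀ hd0 (by positivity) hfin

end Norm

theorem isIntegral_of_pow_eq_one {μ : ℂ} {n : ℕ} (hn : 0 < n) (h : μ ^ n = 1) : IsIntegral ℤ μ :=
  IsIntegral.of_pow hn (h ▸ isIntegral_one)

/-- For a primitive `q`-th root of unity `ζ`, the number `(2 - ζ - ζ⁻¹) ^ (q - 1)` divides `q ^ 2`
among the algebraic integers. -/
theorem exists_pow_mul_eq_sq {ζ : ℂ} {q : ℕ} (hq : 0 < q) (hζ : IsPrimitiveRoot ζ q) :
    ∃ w : ℂ, IsIntegral ℤ w ∧ (2 - ζ - ζ⁻¹) ^ (q - 1) * w = (q ^ 2 : ℕ) := by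
  -- `q` is the product of `1 - ξ ^ k` over `0 < k < q`, and each factor is a multiple of `1 - ξ`.
  have key : ∀ ξ : ℂ, IsPrimitiveRoot ξ q →
      ∃ w : ℂ, IsIntegral ℤ w ∧ (q : ℂ) = w * (ξ - 1) ^ (q - 1) := fun ξ hξ => by
    obtain ⟨w, hw, h⟩ := hξ.self_sub_one_pow_dvd_order (Nat.sub_lt hq one_pos)
    exact ⟨w, IsIntegral.of_mem_of_fg _ (isIntegral_of_pow_eq_one hq hξ.pow_eq_one).fg_adjoin_singleton
      _ hw, h⟩
  obtain ⟨w, hw, h⟩ := key ζ hζ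
  obtain ⟨w', hw', h'⟩ := key ζ⁻¹ hζ.inv
  have hζ0 : ζ ≠ 0 := hζ.ne_zero hq.ne'
  refine ⟨w * w', hw.mul hw', ?_⟩
  have hu : 2 - ζ - ζ⁻¹ = (ζ - 1) * (ζ⁻¹ - 1) := by field_simp; ring
  rw [hu, mul_pow]
  push_cast
  linear_combination -(q : ℂ) * h' - w' * (ζ⁻¹ - 1) ^ (q - 1) * h

/-! ### Bounding the order of the roots of unity -/

namespace FiniteStable

/-- As a quadratic form in `y, z` this has discriminant `x² - 4 < 0`. -/
theorem sub_pos {x y z : ℝ} (hx : |x| < 2) (h : y ≠ 0 ∨ z ≠ 0) :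
    0 < y ^ 2 + z ^ 2 - x * y * z := by
  have h1 := abs_lt.1 hx
  have hx2 : 0 < 4 - x ^ 2 := by nlinarith
  rcases eq_or_ne z 0 with rfl | hz
  · have : y ≠ 0 := h.resolve_right (by simp)
    simpa using sq_pos_iff.2 this
  · have : 0 < z ^ 2 := by positivity
    nlinarith [sq_nonneg (2 * y - x * z), mul_pos hx2 this]

theorem isIntegral {T : Set (ℂ × ℂ × ℂ)} (hT : FiniteStable T) {x y z : ℂ} (ht : (x, y, z) ∈ T) :
    IsIntegral ℤ x := by
  obtain ⟨μ, hx, -, n, hn, hμ⟩ := hT.exists_root_of_unity ht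
  rw [hx]
  exact (isIntegral_of_pow_eq_one hn hμ).add
    (isIntegral_of_pow_eq_one hn (by rw [inv_pow, hμ, inv_one]))

theorem two_pow_le_of_finiteDimensional {T : Set (ℂ × ℂ × ℂ)} (hT : FiniteStable T)
    (L : IntermediateField ℚ ℂ) [FiniteDimensional ℚ L] {x y z w : L}
    (ht : ((x : ℂ), (y : ℂ), (z : ℂ)) ∈ T) (hw : IsIntegral ℤ (w : ℂ)) {m c : ℕ} (hc : c ≠ 0)
    (h : (4 - (x : ℂ) ^ 2) ^ m * w = c) : 2 ^ m ≤ c := by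
  have hdown : ∀ v : L, IsIntegral ℤ (v : ℂ) → IsIntegral ℤ v := fun v hv =>
    (isIntegral_algHom_iff (L.val.restrictScalars ℤ) Subtype.val_injective).1 hv
  have hix := hdown x (hT.isIntegral ht)
  have hiy := hdown y (hT.isIntegral (hT.shift (hT.shift ht)))
  have hiz := hdown z (hT.isIntegral (hT.shift ht))
  have hTL := hT.preimage (algebraMap L ℂ)
  have htL : (x, y, z) ∈ mapTriple (algebraMap L ℂ) ⁻¹' T := ht
  have hi4 : IsIntegral ℤ (4 : L) := by
    simpa using (isIntegral_algebraMap (R := ℤ) (A := L) (x := 4))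
  -- The image of the stable set under `σ` is again finite and stable, so the real bounds hold at
  -- every embedding.
  have hreal : ∀ σ : L →ₐ[ℚ] ℂ, ∃ r s t : ℝ, σ x = r ∧ σ y = s ∧ σ z = t ∧ |r| < 2 ∧
      (s ≠ 0 ∨ t ≠ 0) ∧ r ^ 2 + s ^ 2 + t ^ 2 - r * s * t < 4 := fun σ => by
    have hσ := hTL.image (σ : L →+* ℂ)
    have hmem : (σ x, σ y, σ z) ∈ mapTriple (σ : L →+* ℂ) '' (mapTriple (algebraMap L ℂ) ⁻¹' T) :=
      ⟨_, htL, rfl⟩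
    obtain ⟨r, hr, hr2⟩ := hσ.exists_real hmem
    obtain ⟨s, hs, -⟩ := hσ.exists_real (hσ.shift (hσ.shift hmem))
    obtain ⟨t, ht, -⟩ := hσ.exists_real (hσ.shift hmem)
    rw [hr, hs, ht] at hmem
    exact ⟨r, s, t, hr, hs, ht, hr2, by simpa using hσ.admissible hmem, hσ.lt_four_of_complex hmem⟩
  -- The summands are `4 - ω` and `ω - x²`.
  refine two_pow_le_of_totallyPositive (a := 4 - (x ^ 2 + y ^ 2 + z ^ 2 - x * y * z))
    (b := y ^ 2 + z ^ 2 - x * y * z) (w := w) ?_ ?_ (hdown w hw) (fun σ => ?_) (fun σ => ?_) hc ?_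
  · exact hi4.sub ((((hix.pow 2).add (hiy.pow 2)).add (hiz.pow 2)).sub ((hix.mul hiy).mul hiz))
  · exact ((hiy.pow 2).add (hiz.pow 2)).sub ((hix.mul hiy).mul hiz)
  · obtain ⟨r, s, t, hr, hs, ht, -, -, h4⟩ := hreal σ
    refine ⟨4 - (r ^ 2 + s ^ 2 + t ^ 2 - r * s * t), by linarith, ?_⟩
    simp [hr, hs, ht, map_ofNat]
  · obtain ⟨r, s, t, hr, hs, ht, hr2, hst, -⟩ := hreal σ
    refine ⟨s ^ 2 + t ^ 2 - r * s * t, sub_pos hr2 hst, ?_⟩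
    simp [hr, hs, ht]
  · apply Subtype.val_injective
    rw [← show (4 - x ^ 2 : L) = 4 - (x ^ 2 + y ^ 2 + z ^ 2 - x * y * z) +
      (y ^ 2 + z ^ 2 - x * y * z) by ring]
    push_cast
    exact h

/-- If `4 - x ^ 2` divides the positive integer `c` to the `m`-th power, then `2 ^ m ≤ c`. -/
theorem two_pow_le {T : Set (ℂ × ℂ × ℂ)} (hT : FiniteStable T) {x y z : ℂ} (ht : (x, y, z) ∈ T)
    {w : ℂ} (hw : IsIntegral ℤ w) {m c : ℕ} (hc : c ≠ 0) (h : (4 - x ^ 2) ^ m * w = c) :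
    2 ^ m ≤ c := by
  have hsub := IntermediateField.subset_adjoin ℚ ({x, y, z, w} : Set ℂ)
  have : FiniteDimensional ℚ (IntermediateField.adjoin ℚ ({x, y, z, w} : Set ℂ)) := by
    refine IntermediateField.finiteDimensional_adjoin fun v hv => ?_
    rcases hv with rfl | rfl | rfl | rfl
    exacts [(hT.isIntegral ht).tower_top, (hT.isIntegral (hT.shift (hT.shift ht))).tower_top,
      (hT.isIntegral (hT.shift ht)).tower_top, hw.tower_top]
  exact hT.two_pow_le_of_finiteDimensional _ (x := ⟨x, hsub (by simp)⟩) (y := ⟨y, hsub (by simp)⟩)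
    (z := ⟨z, hsub (by simp)⟩) (w := ⟨w, hsub (by simp)⟩) ht hw hc h

/-- The inequality fails at `q = 6`, where `36 > 32`, so that order needs its own argument. -/
theorem sq_lt_two_pow {q : ℕ} (hq : 7 ≤ q) : q ^ 2 < 2 ^ (q - 1) := by
  induction q, hq using Nat.le_induction with
  | base => norm_num
  | succ n hn ih =>
    obtain ⟨k, rfl⟩ := Nat.exists_eq_add_of_le' (show 1 ≤ n by omega)
    simp only [Nat.add_sub_cancel] at ih ⊢
    rw [pow_succ 2]
    nlinarith

/-- Every coordinate `x` of a triple satisfies `x ^ 2 = 0`, `1`, `2`, or `x ^ 4 - 3 x ^ 2 + 1 = 0`. -/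
theorem sq_eq {T : Set (ℂ × ℂ × ℂ)} (hT : FiniteStable T) {x y z : ℂ} (ht : (x, y, z) ∈ T) :
    x ^ 2 = 0 ∨ x ^ 2 = 1 ∨ x ^ 2 = 2 ∨ (x ^ 2) ^ 2 - 3 * x ^ 2 + 1 = 0 := by
  obtain ⟨μ, hx, hsq, n, hn, hμ⟩ := hT.exists_root_of_unity ht
  have hμ0 : μ ≠ 0 := by rintro rfl; simp [hn.ne'] at hμ
  obtain ⟨ζ, hζ⟩ : ∃ ζ, ζ = μ ^ 2 := ⟨_, rfl⟩
  have hζ0 : ζ ≠ 0 := hζ ▸ pow_ne_zero 2 hμ0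
  have hx2 : x ^ 2 = ζ + 2 + ζ⁻¹ := by rw [hx, hζ]; field_simp; ring
  have hprim := IsPrimitiveRoot.orderOf ζ
  have hq0 : 0 < orderOf ζ := by
    rw [orderOf_pos_iff, isOfFinOrder_iff_pow_eq_one]
    exact ⟨n, hn, by rw [hζ, ← pow_mul, mul_comm, pow_mul, hμ, one_pow]⟩
  have hu : 4 - x ^ 2 = 2 - ζ - ζ⁻¹ := by rw [hx2]; ring
  generalize orderOf ζ = q at hprim hq0
  have hq1 : q ≠ 1 := by
    rintro rfl
    exact hsq (hζ ▸ IsPrimitiveRoot.one_right_iff.1 hprim)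
  have hq7 : q < 7 := by
    by_contra! h7
    obtain ⟨w, hw, h⟩ := exists_pow_mul_eq_sq hq0 hprim
    rw [← hu] at h
    exact absurd (hT.two_pow_le ht hw (by positivity) h) (sq_lt_two_pow h7).not_ge
  have hne : ∀ k, 0 < k → k < q → ζ ^ k - 1 ≠ 0 := fun k h0 hk => by
    rw [sub_ne_zero]
    exact hprim.pow_ne_one_of_pos_of_lt h0.ne' hk
  have hp := hprim.pow_eq_one
  -- `x² = s` is equivalent to a quadratic equation for `ζ`; for `q = 2, 3, 4, 6` it follows by
  -- cancelling factors of `ζ ^ q - 1`.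
  have inv_eq : ∀ s, ζ ^ 2 - (s - 2) * ζ + 1 = 0 → x ^ 2 = s := fun s hs => by
    rw [hx2]; field_simp; linear_combination hs
  interval_cases q
  · exact absurd rfl hq1
  · left
    have h1 := hne 1 (by norm_num) (by norm_num)
    refine inv_eq _ (mul_left_cancel₀ h1 ?_)
    linear_combination (ζ + 1) * hp
  · right; left
    have h1 := hne 1 (by norm_num) (by norm_num)
    refine inv_eq _ (mul_left_cancel₀ h1 ?_)
    linear_combination hp
  · right; right; left
    have h1 := hne 2 (by norm_num) (by norm_num)
    refine inv_eq _ (mul_left_cancel₀ h1 ?_)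
    linear_combination hp
  · right; right; right
    have h1 := hne 1 (by norm_num) (by norm_num)
    have h2 : ζ ^ 4 + ζ ^ 3 + ζ ^ 2 + ζ + 1 = 0 := by
      refine mul_left_cancel₀ h1 ?_
      linear_combination hp
    rw [hx2]
    field_simp
    linear_combination h2
  -- Order six: `x² = 3`, so `4 - x² = 1` and the norm bound would read `2 ≤ 1`.
  · exfalso
    have h2 := hne 2 (by norm_num) (by norm_num)
    have h3 := hne 3 (by norm_num) (by norm_num)
    have h4 : ζ ^ 2 - ζ + 1 = 0 := by
      have h5 : ζ ^ 3 + 1 = 0 := by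
        refine mul_left_cancel₀ h3 ?_
        linear_combination hp
      refine mul_left_cancel₀ h2 ?_
      linear_combination (ζ - 1) * h5
    have h1 : (4 - x ^ 2) ^ 1 * 1 = ((1 : ℕ) : ℂ) := by
      rw [inv_eq 3 (by linear_combination h4)]; norm_num
    have := hT.two_pow_le ht isIntegral_one one_ne_zero h1
    norm_num at this

end FiniteStable

/-! ### Exact arithmetic in `ℤ[√2, φ]` -/

/-- The ring `ℤ[√2, φ]`, `φ` the golden ratio, in the basis `1, √2, φ, √2 φ`. -/
@[ext]
structure QuarticInt where
  a : ℤ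
  b : ℤ
  c : ℤ
  d : ℤ
deriving DecidableEq

namespace QuarticInt

def neg (u : QuarticInt) : QuarticInt := ⟨-u.a, -u.b, -u.c, -u.d⟩

def sub (u v : QuarticInt) : QuarticInt := ⟨u.a - v.a, u.b - v.b, u.c - v.c, u.d - v.d⟩

def mul (u v : QuarticInt) : QuarticInt where
  a := u.a * v.a + 2 * (u.b * v.b) + (u.c * v.c + 2 * (u.d * v.d))
  b := u.a * v.b + u.b * v.a + (u.c * v.d + u.d * v.c)
  c := u.a * v.c + 2 * (u.b * v.d) + (u.c * v.a + 2 * (u.d * v.b)) + (u.c * v.c + 2 * (u.d * v.d))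
  d := u.a * v.d + u.b * v.c + (u.c * v.b + u.d * v.a) + (u.c * v.d + u.d * v.c)

/-- The value as a complex number. -/
noncomputable def val (u : QuarticInt) : ℂ :=
  ((u.a + u.b * √2 + (u.c + u.d * √2) * Real.goldenRatio : ℝ) : ℂ)

theorem sqrt_two_sq : ((√2 : ℝ) : ℂ) ^ 2 = 2 := by
  rw [← Complex.ofReal_pow, Real.sq_sqrt (by norm_num)]; norm_num

theorem golden_sq : (Real.goldenRatio : ℂ) ^ 2 = Real.goldenRatio + 1 := by
  rw [← Complex.ofReal_pow, Real.goldenRatio_sq]; push_cast; rfl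

theorem val_eq (u : QuarticInt) : u.val =
    u.a + u.b * (√2 : ℝ) + (u.c + u.d * (√2 : ℝ)) * (Real.goldenRatio : ℝ) := by
  simp only [val, Complex.ofReal_add, Complex.ofReal_mul, Complex.ofReal_intCast]

theorem val_neg (u : QuarticInt) : u.neg.val = -u.val := by
  simp only [val_eq, neg]; push_cast; ring

theorem val_sub (u v : QuarticInt) : (u.sub v).val = u.val - v.val := by
  simp only [val_eq, sub]; push_cast; ring

theorem val_mul (u v : QuarticInt) : (u.mul v).val = u.val * v.val := by
  simp only [val_eq, mul]
  generalize hs : ((√2 : ℝ) : ℂ) = s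
  generalize hp : (Real.goldenRatio : ℂ) = p
  have h2 : s ^ 2 = 2 := by rw [← hs, sqrt_two_sq]
  have h1 : p ^ 2 = p + 1 := by rw [← hp, golden_sq]
  push_cast
  linear_combination -(u.b * v.b + (u.b * v.d + u.d * v.b) * p + u.d * v.d * (p + 1)) * h2 -
    (u.c + u.d * s) * (v.c + v.d * s) * h1

/-- Infinite descent at `5`: since `-2` is not a square modulo `5`, the form `A² + 2B²` is
anisotropic there, so all four integers are divisible by `5`. -/
theorem eq_zero_of_form {A B C D : ℤ} (h : A ^ 2 + 2 * B ^ 2 = 5 * (C ^ 2 + 2 * D ^ 2)) :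
    A = 0 ∧ B = 0 ∧ C = 0 ∧ D = 0 := by
  have dvd : ∀ {A B : ℤ}, (5 : ℤ) ∣ A ^ 2 + 2 * B ^ 2 → 5 ∣ A ∧ 5 ∣ B := fun {A B} h => by
    have key : ∀ a b : ZMod 5, a ^ 2 + 2 * b ^ 2 = 0 → a = 0 ∧ b = 0 := by decide
    have h' := (ZMod.intCast_zmod_eq_zero_iff_dvd _ 5).2 h
    push_cast at h'
    obtain ⟨ha, hb⟩ := key _ _ h'
    exact ⟨(ZMod.intCast_zmod_eq_zero_iff_dvd _ 5).1 ha, (ZMod.intCast_zmod_eq_zero_iff_dvd _ 5).1 hb⟩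
  have zero : ∀ n : ℕ, ∀ A B C D : ℤ, A ^ 2 + 2 * B ^ 2 + (C ^ 2 + 2 * D ^ 2) ≤ n →
      A ^ 2 + 2 * B ^ 2 = 5 * (C ^ 2 + 2 * D ^ 2) → C ^ 2 + 2 * D ^ 2 = 0 := by
    intro n
    induction n using Nat.strong_induction_on with
    | _ n ih =>
      intro A B C D hn h
      by_contra hne
      obtain ⟨⟨A', rfl⟩, ⟨B', rfl⟩⟩ := dvd ⟨_, h⟩
      obtain ⟨⟨C', rfl⟩, ⟨D', rfl⟩⟩ := dvd (A := C) (B := D)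
        ⟨A' ^ 2 + 2 * B' ^ 2, by linarith⟩
      have hpos : 0 < C' ^ 2 + 2 * D' ^ 2 :=
        lt_of_le_of_ne (by positivity) fun h0 => hne (by linear_combination -25 * h0)
      have h0 : 0 ≤ A' ^ 2 + 2 * B' ^ 2 := by positivity
      obtain ⟨m, hm⟩ := Int.eq_ofNat_of_zero_le (add_nonneg h0 hpos.le)
      refine hpos.ne' (ih m ?_ A' B' C' D' hm.le (by linarith))
      zify
      rw [← hm]
      linarith
  have hCD := zero _ A B C D (Int.toNat_of_nonneg (by positivity)).ge h
  rw [hCD, mul_zero] at h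
  have hA : A ^ 2 = 0 := by nlinarith [sq_nonneg A, sq_nonneg B]
  have hB : B ^ 2 = 0 := by nlinarith [sq_nonneg A, sq_nonneg B]
  have hC : C ^ 2 = 0 := by nlinarith [sq_nonneg C, sq_nonneg D]
  have hD : D ^ 2 = 0 := by nlinarith [sq_nonneg C, sq_nonneg D]
  simp only [ne_eq, OfNat.ofNat_ne_zero, not_false_eq_true, pow_eq_zero_iff] at hA hB hC hD
  exact ⟨hA, hB, hC, hD⟩

theorem eq_zero_of_val_eq_zero {u : QuarticInt} (h : u.val = 0) : u = ⟨0, 0, 0, 0⟩ := by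
  have h0 : (u.a + u.b * √2 + (u.c + u.d * √2) * Real.goldenRatio : ℝ) = 0 :=
    Complex.ofReal_eq_zero.1 h
  have h2 : √2 ^ 2 = (2 : ℝ) := Real.sq_sqrt (by norm_num)
  have h5 : √5 ^ 2 = (5 : ℝ) := Real.sq_sqrt (by norm_num)
  have hirr : ∀ m n : ℤ, (m : ℝ) + n * √2 = 0 → m = 0 := fun m n hmn => by
    by_contra hm
    have hn : n ≠ 0 := by
      rintro rfl
      simp [hm] at hmn
    exact ((irrational_sqrt_two.intCast_mul hn).intCast_add m).ne_zero hmn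
  -- Doubling clears the denominator of `φ = (1 + √5) / 2` and isolates `√5`. Squaring this and
  -- taking the part free of `√2` gives `hform`.
  have hlin : ((2 * u.a + u.c : ℤ) : ℝ) + (2 * u.b + u.d : ℤ) * √2 =
      -((u.c : ℝ) + u.d * √2) * √5 := by
    rw [Real.goldenRatio] at h0
    push_cast
    linear_combination 2 * h0
  have hform : (2 * u.a + u.c) ^ 2 + 2 * (2 * u.b + u.d) ^ 2 = 5 * (u.c ^ 2 + 2 * u.d ^ 2) := by
    refine sub_eq_zero.1 (hirr _ (2 * (2 * u.a + u.c) * (2 * u.b + u.d) - 10 * (u.c * u.d)) ?_)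
    have hsq := congrArg (· ^ 2) hlin
    simp only [mul_pow, h5] at hsq
    push_cast at hsq ⊢
    linear_combination hsq + (5 * (u.d : ℝ) ^ 2 - (2 * u.b + u.d) ^ 2) * h2
  obtain ⟨hA, hB, hC, hD⟩ := eq_zero_of_form hform
  ext <;> simp only <;> omega

/-- This turns equality of complex values into decidable equality of integer coordinates. -/
theorem val_injective : Function.Injective val := by
  intro u v h
  have h0 : u.sub v = ⟨0, 0, 0, 0⟩ := eq_zero_of_val_eq_zero (by rw [val_sub, h, sub_self])
  simp only [sub, QuarticInt.mk.injEq, sub_eq_zero] at h0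
  exact QuarticInt.ext h0.1 h0.2.1 h0.2.2.1 h0.2.2.2

theorem val_zero : val ⟨0, 0, 0, 0⟩ = 0 := by simp [val]
theorem val_one : val ⟨1, 0, 0, 0⟩ = 1 := by simp [val]
theorem val_sqrt_two : val ⟨0, 1, 0, 0⟩ = (√2 : ℝ) := by simp [val]
theorem val_golden : val ⟨0, 0, 1, 0⟩ = (Real.goldenRatio : ℝ) := by simp [val]
theorem val_golden_sub_one : val ⟨-1, 0, 1, 0⟩ = (Real.goldenRatio : ℝ) - 1 := by
  simp [val_eq]; ring

/-- The numbers `0, ±1, ±√2, ±φ, ±(φ - 1)`. -/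
def coords : List QuarticInt :=
  [⟨0, 0, 0, 0⟩, ⟨1, 0, 0, 0⟩, ⟨-1, 0, 0, 0⟩, ⟨0, 1, 0, 0⟩, ⟨0, -1, 0, 0⟩, ⟨0, 0, 1, 0⟩,
    ⟨0, 0, -1, 0⟩, ⟨-1, 0, 1, 0⟩, ⟨1, 0, -1, 0⟩]

theorem exists_coords_of_sq {x : ℂ}
    (h : x ^ 2 = 0 ∨ x ^ 2 = 1 ∨ x ^ 2 = 2 ∨ (x ^ 2) ^ 2 - 3 * x ^ 2 + 1 = 0) :
    ∃ u ∈ coords, u.val = x := by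
  have neg_mk : ∀ {u : QuarticInt} {v}, u.neg = v → v.val = -u.val := by
    rintro u _ rfl; exact val_neg u
  have key : ∀ {u v : QuarticInt}, u ∈ coords → v ∈ coords → u.neg = v → x ^ 2 = u.val ^ 2 →
      ∃ u ∈ coords, u.val = x := fun {u v} hu hv huv hx => by
    rcases sq_eq_sq_iff_eq_or_eq_neg.1 hx with h | h
    · exact ⟨u, hu, h.symm⟩
    · exact ⟨v, hv, by rw [neg_mk huv, h]⟩
  rcases h with h | h | h | h
  · exact ⟨⟨0, 0, 0, 0⟩, by decide, by rw [val_zero, pow_eq_zero_iff two_ne_zero |>.1 h]⟩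
  · exact key (u := ⟨1, 0, 0, 0⟩) (v := ⟨-1, 0, 0, 0⟩) (by decide) (by decide) (by decide)
      (by rw [h, val_one, one_pow])
  · exact key (u := ⟨0, 1, 0, 0⟩) (v := ⟨0, -1, 0, 0⟩) (by decide) (by decide) (by decide)
      (by rw [h, val_sqrt_two, sqrt_two_sq])
  -- The roots of `X² - 3X + 1` are `φ²` and `φ⁻² = (φ - 1)²`.
  · have hf : (x ^ 2 - (Real.goldenRatio : ℂ) ^ 2) * (x ^ 2 - ((Real.goldenRatio : ℂ) - 1) ^ 2) = 0 := by
      have hg := golden_sq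
      generalize (Real.goldenRatio : ℂ) = p at hg
      linear_combination h + (-2 * x ^ 2 + 1 + p ^ 2 - p) * hg
    rcases mul_eq_zero.1 hf with h' | h'
    · exact key (u := ⟨0, 0, 1, 0⟩) (v := ⟨0, 0, -1, 0⟩) (by decide) (by decide) (by decide)
        (by rw [val_golden]; exact sub_eq_zero.1 h')
    · exact key (u := ⟨-1, 0, 1, 0⟩) (v := ⟨1, 0, -1, 0⟩) (by decide) (by decide) (by decide)
        (by rw [val_golden_sub_one]; exact sub_eq_zero.1 h')

end QuarticInt

/-! ### Computation of the five orbits -/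

/-- Triples of elements of `ℤ[√2, φ]`. -/
@[ext]
structure QuarticTriple where
  x : QuarticInt
  y : QuarticInt
  z : QuarticInt
deriving DecidableEq

namespace QuarticTriple

open QuarticInt

/-- The action of `β₁`. -/
def braid₁ (t : QuarticTriple) : QuarticTriple := ⟨t.x.neg, t.z.sub (t.x.mul t.y), t.y⟩

/-- The action of `β₂`. -/
def braid₂ (t : QuarticTriple) : QuarticTriple := ⟨t.z, t.y.neg, t.x.sub (t.y.mul t.z)⟩

/-- The action of `β₁⁻¹`. -/
def braidInv₁ (t : QuarticTriple) : QuarticTriple := ⟨t.x.neg, t.z, t.y.sub (t.x.mul t.z)⟩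

/-- The action of `β₂⁻¹`. -/
def braidInv₂ (t : QuarticTriple) : QuarticTriple := ⟨t.z.sub (t.x.mul t.y), t.y.neg, t.x⟩

/-- The triples equivalent to a given one. -/
def equivalents (t : QuarticTriple) : List QuarticTriple :=
  [t, ⟨t.x.neg, t.y.neg, t.z⟩, ⟨t.x.neg, t.y, t.z.neg⟩, ⟨t.x, t.y.neg, t.z.neg⟩]

/-- Search for the orbit of a triple under the monoid generated by `β₁` and `β₂`. -/
def explore : ℕ → List QuarticTriple → List QuarticTriple → List QuarticTriple
  | 0, _, seen => seen
  | _ + 1, [], seen => seen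
  | n + 1, t :: todo, seen =>
    let new := [t.braid₁, t.braid₂].filter (· ∉ seen)
    explore n (new ++ todo) (new ++ seen)

theorem forall_mem_explore {p : QuarticTriple → Prop} (h₁ : ∀ t, p t → p t.braid₁)
    (h₂ : ∀ t, p t → p t.braid₂) (n : ℕ) : ∀ todo seen : List QuarticTriple,
    (∀ t ∈ todo, p t) → (∀ t ∈ seen, p t) → ∀ t ∈ explore n todo seen, p t := by
  induction n with
  | zero => exact fun _ _ _ h => h
  | succ n ih =>
    rintro (_ | ⟨t, todo⟩) seen htodo hseen
    · exact hseen
    · have hnew : ∀ s ∈ [t.braid₁, t.braid₂].filter (· ∉ seen), p s := fun s hs => by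
        have ht := htodo t (by simp)
        have := (List.mem_filter.1 hs).1
        simp only [List.mem_cons, List.not_mem_nil, or_false] at this
        rcases this with rfl | rfl
        exacts [h₁ t ht, h₂ t ht]
      refine ih _ _ (fun s hs => ?_) (fun s hs => ?_)
      · rcases List.mem_append.1 hs with hs | hs
        exacts [hnew s hs, htodo s (List.mem_cons_of_mem _ hs)]
      · rcases List.mem_append.1 hs with hs | hs
        exacts [hnew s hs, hseen s hs]

/-- The five representatives. -/
def base : Fin 5 → QuarticTriple :=
  ![⟨⟨0, 0, 0, 0⟩, ⟨-1, 0, 0, 0⟩, ⟨-1, 0, 0, 0⟩⟩,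
    ⟨⟨0, 0, 0, 0⟩, ⟨-1, 0, 0, 0⟩, ⟨0, -1, 0, 0⟩⟩,
    ⟨⟨0, 0, 0, 0⟩, ⟨-1, 0, 0, 0⟩, ⟨0, 0, -1, 0⟩⟩,
    ⟨⟨0, 0, 0, 0⟩, ⟨-1, 0, 0, 0⟩, ⟨1, 0, -1, 0⟩⟩,
    ⟨⟨0, 0, 0, 0⟩, ⟨0, 0, -1, 0⟩, ⟨1, 0, -1, 0⟩⟩]

/-- The orbits of the five representatives. -/
def orbitList (i : Fin 5) : List QuarticTriple := explore 72 [base i] [base i]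

/-- One member of each equivalence class in the orbit of a representative. -/
def classList (i : Fin 5) : List QuarticTriple :=
  (orbitList i).foldr (fun t l => if ∃ s ∈ l, t ∈ s.equivalents then l else t :: l) []

theorem braid_mem_orbitList : ∀ i, ∀ t ∈ orbitList i, t.braid₁ ∈ orbitList i ∧
    t.braid₂ ∈ orbitList i ∧ t.braidInv₁ ∈ orbitList i ∧ t.braidInv₂ ∈ orbitList i := by
  decide +kernel

theorem base_mem_orbitList : ∀ i, base i ∈ orbitList i := by decide +kernel

theorem length_classList : ∀ i, (classList i).length = (![4, 9, 10, 10, 18] : Fin 5 → ℕ) i := by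
  decide +kernel

theorem mem_orbitList_of_mem_classList : ∀ i, ∀ t ∈ classList i, t ∈ orbitList i := by
  decide +kernel

theorem exists_mem_classList : ∀ i, ∀ t ∈ orbitList i, ∃ s ∈ classList i, s ∈ t.equivalents := by
  decide +kernel

theorem pairwise_classList : ∀ i, (classList i).Pairwise fun s t => s ∉ t.equivalents := by
  decide +kernel

/-- This separates the five orbits even after passing to classes. -/
theorem notMem_equivalents_base : ∀ i j, i ≠ j → ∀ t ∈ orbitList i, t ∉ (base j).equivalents := by
  decide +kernel

/-- The invariant `x² + y² + z² - xyz`. -/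
def form (t : QuarticTriple) : QuarticInt :=
  -- In the absence of an addition, `x² + y² + z²` is written as `x² - (-y² - z²)`.
  ((t.x.mul t.x).sub ((t.y.mul t.y).neg.sub (t.z.mul t.z))).sub ((t.x.mul t.y).mul t.z)

/-- All coordinates are among `0, ±1, ±√2, ±φ, ±(φ - 1)`. -/
abbrev InCoords (t : QuarticTriple) : Prop := t.x ∈ coords ∧ t.y ∈ coords ∧ t.z ∈ coords

/-- At most one coordinate is zero. -/
abbrev AtMostOneZero (t : QuarticTriple) : Prop :=
  (t.x ≠ ⟨0, 0, 0, 0⟩ ∨ t.y ≠ ⟨0, 0, 0, 0⟩) ∧ (t.x ≠ ⟨0, 0, 0, 0⟩ ∨ t.z ≠ ⟨0, 0, 0, 0⟩) ∧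
    (t.y ≠ ⟨0, 0, 0, 0⟩ ∨ t.z ≠ ⟨0, 0, 0, 0⟩)

/-- The coordinates remain in the list under at most two braid moves. -/
def Stays (t : QuarticTriple) : Prop :=
  InCoords t.braid₁ ∧ InCoords t.braid₂ ∧ InCoords t.braid₁.braid₁ ∧ InCoords t.braid₂.braid₁ ∧
    InCoords t.braid₁.braid₂ ∧ InCoords t.braid₂.braid₂

instance : DecidablePred Stays := fun t => by unfold Stays; infer_instance

/-- The exhaustive check over the `9³` candidate triples: two moves suffice to discard every
candidate outside the five orbits. -/
theorem exists_mem_orbitList : ∀ x ∈ coords, ∀ y ∈ coords, ∀ z ∈ coords, Stays ⟨x, y, z⟩ →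
    AtMostOneZero ⟨x, y, z⟩ → form ⟨x, y, z⟩ ≠ ⟨4, 0, 0, 0⟩ →
    ∃ i, (⟨x, y, z⟩ : QuarticTriple) ∈ orbitList i := by
  decide +kernel

/-! ### Comparison with the braid action on complex triples -/

/-- The value as a triple of complex numbers. -/
noncomputable def val (t : QuarticTriple) : Triple := ⟨t.x.val, t.y.val, t.z.val⟩

theorem val_injective : Function.Injective val := by
  intro s t h
  simp only [val, Triple.mk.injEq] at h
  exact QuarticTriple.ext (QuarticInt.val_injective h.1) (QuarticInt.val_injective h.2.1)
    (QuarticInt.val_injective h.2.2)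

theorem val_braid₁ (t : QuarticTriple) : t.braid₁.val = beta₁ t.val := by
  simp [val, braid₁, beta₁, val_neg, val_sub, val_mul]

theorem val_braid₂ (t : QuarticTriple) : t.braid₂.val = beta₂ t.val := by
  simp [val, braid₂, beta₂, val_neg, val_sub, val_mul]

theorem val_braidInv₁ (t : QuarticTriple) : t.braidInv₁.val = beta₁.symm t.val := by
  simp [val, braidInv₁, beta₁, val_neg, val_sub, val_mul]

theorem val_braidInv₂ (t : QuarticTriple) : t.braidInv₂.val = beta₂.symm t.val := by
  simp [val, braidInv₂, beta₂, val_neg, val_sub, val_mul]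

theorem of_zero_smul_eq (t : Triple) : (PresentedGroup.of 0 : B₃) • t = beta₁ t := of_zero_smul t

theorem of_one_smul_eq (t : Triple) : (PresentedGroup.of 1 : B₃) • t = beta₂ t := of_one_smul t

theorem val_equivalent_iff {s t : QuarticTriple} :
    s.val.Equivalent t.val ↔ s ∈ t.equivalents := by
  simp only [equivalents, List.mem_cons, List.not_mem_nil, or_false, Triple.Equivalent,
    ← val_injective.eq_iff, val, val_neg]

theorem val_admissible_iff {t : QuarticTriple} : t.val.Admissible ↔ t.AtMostOneZero := by
  simp only [Triple.Admissible, AtMostOneZero, val, ne_eq, ← QuarticInt.val_injective.eq_iff,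
    QuarticInt.val_zero]

theorem val_nonFlat_iff {t : QuarticTriple} : t.val.NonFlat ↔ t.form ≠ ⟨4, 0, 0, 0⟩ := by
  have h4 : QuarticInt.val ⟨4, 0, 0, 0⟩ = 4 := by simp [QuarticInt.val_eq]
  have hf : t.form.val = t.x.val ^ 2 + t.y.val ^ 2 + t.z.val ^ 2 - t.x.val * t.y.val * t.z.val := by
    simp only [form, val_sub, val_mul, val_neg]
    ring
  rw [ne_eq, ← QuarticInt.val_injective.eq_iff, h4, hf]
  rfl

theorem mem_orbit_base_iff {i : Fin 5} {t : Triple} :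
    t ∈ MulAction.orbit B₃ (base i).val ↔ ∃ q ∈ orbitList i, q.val = t := by
  constructor
  · rintro ⟨g, rfl⟩
    -- Invariance needs both directions for each generator, hence the inverse moves in
    -- `braid_mem_orbitList`.
    refine (smul_iff (p := fun t => ∃ q ∈ orbitList i, q.val = t) (fun t => ?_) (fun t => ?_) g
      (base i).val).2 ⟨_, base_mem_orbitList i, rfl⟩
    · constructor
      · rintro ⟨q, hq, h⟩
        exact ⟨_, (braid_mem_orbitList i q hq).2.2.1, by
          rw [val_braidInv₁, h, Equiv.symm_apply_apply]⟩
      · rintro ⟨q, hq, rfl⟩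
        exact ⟨_, (braid_mem_orbitList i q hq).1, val_braid₁ q⟩
    · constructor
      · rintro ⟨q, hq, h⟩
        exact ⟨_, (braid_mem_orbitList i q hq).2.2.2, by
          rw [val_braidInv₂, h, Equiv.symm_apply_apply]⟩
      · rintro ⟨q, hq, rfl⟩
        exact ⟨_, (braid_mem_orbitList i q hq).2.1, val_braid₂ q⟩
  · rintro ⟨q, hq, rfl⟩
    refine forall_mem_explore (p := fun q => q.val ∈ MulAction.orbit B₃ (base i).val)
      (fun t ht => ?_) (fun t ht => ?_) 72 [base i] [base i] ?_ ?_ q hq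
    · rw [val_braid₁, ← of_zero_smul_eq]
      exact MulAction.mem_orbit_of_mem_orbit _ ht
    · rw [val_braid₂, ← of_one_smul_eq]
      exact MulAction.mem_orbit_of_mem_orbit _ ht
    · simp [MulAction.mem_orbit_self]
    · simp [MulAction.mem_orbit_self]

/-- The representative, as an admissible triple. -/
noncomputable def basePoint (i : Fin 5) : admissibleNonFlat :=
  ⟨(base i).val, by
    refine ⟨val_admissible_iff.2 ?_, val_nonFlat_iff.2 ?_⟩
    · revert i; decide
    · revert i; decide⟩

theorem mem_orbit_basePoint_iff {i : Fin 5} {t : admissibleNonFlat} :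
    t ∈ MulAction.orbit B₃ (basePoint i) ↔ ∃ q ∈ orbitList i, q.val = t := by
  rw [← mem_orbit_base_iff]
  exact SubMulAction.mem_orbit_subMul_iff (x := t) (m := basePoint i)

theorem neg_two_mul_cos {r : ℚ} {θ v : ℝ} (hr : Real.pi * r = θ) (hv : -2 * Real.cos θ = v) :
    -2 * Complex.cos (Real.pi * r) = v := by
  rw [← hv, ← hr]
  push_cast
  rfl

theorem val_base (i : Fin 5) : (base i).val = representative i := by
  have h2 : -2 * Complex.cos (Real.pi * (1 / 2 : ℚ)) = (0 : ℝ) :=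
    neg_two_mul_cos (θ := Real.pi / 2) (by push_cast; ring) (by simp)
  have h3 : -2 * Complex.cos (Real.pi * (1 / 3 : ℚ)) = (-1 : ℝ) :=
    neg_two_mul_cos (θ := Real.pi / 3) (by push_cast; ring) (by simp)
  have h4 : -2 * Complex.cos (Real.pi * (1 / 4 : ℚ)) = (-√2 : ℝ) :=
    neg_two_mul_cos (θ := Real.pi / 4) (by push_cast; ring) (by rw [Real.cos_pi_div_four]; ring)
  have h5 : -2 * Complex.cos (Real.pi * (1 / 5 : ℚ)) = (-Real.goldenRatio : ℝ) :=
    neg_two_mul_cos (θ := Real.pi / 5) (by push_cast; ring) (by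
      rw [Real.cos_pi_div_five, Real.goldenRatio]; ring)
  have h25 : -2 * Complex.cos (Real.pi * (2 / 5 : ℚ)) = (-(Real.goldenRatio - 1) : ℝ) :=
    neg_two_mul_cos (θ := 2 * (Real.pi / 5)) (by push_cast; ring) (by
      have h5 : √5 ^ 2 = (5 : ℝ) := Real.sq_sqrt (by norm_num)
      rw [Real.cos_two_mul, Real.cos_pi_div_five, Real.goldenRatio]
      linear_combination (-1 / 4 : ℝ) * h5)
  have n0 : QuarticInt.val ⟨0, 0, 0, 0⟩ = (0 : ℝ) := by simp [QuarticInt.val]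
  have n1 : QuarticInt.val ⟨-1, 0, 0, 0⟩ = (-1 : ℝ) := by simp [QuarticInt.val]
  have n2 : QuarticInt.val ⟨0, -1, 0, 0⟩ = (-√2 : ℝ) := by simp [QuarticInt.val]
  have n3 : QuarticInt.val ⟨0, 0, -1, 0⟩ = (-Real.goldenRatio : ℝ) := by
    rw [QuarticInt.val]; congr 1; simp
  have n4 : QuarticInt.val ⟨1, 0, -1, 0⟩ = (-(Real.goldenRatio - 1) : ℝ) := by
    rw [QuarticInt.val]; congr 1; push_cast; ring
  fin_cases i
  · exact Triple.ext (n0.trans h2.symm) (n1.trans h3.symm) (n1.trans h3.symm)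
  · exact Triple.ext (n0.trans h2.symm) (n1.trans h3.symm) (n2.trans h4.symm)
  · exact Triple.ext (n0.trans h2.symm) (n1.trans h3.symm) (n3.trans h5.symm)
  · exact Triple.ext (n0.trans h2.symm) (n1.trans h3.symm) (n4.trans h25.symm)
  · exact Triple.ext (n0.trans h2.symm) (n3.trans h5.symm) (n4.trans h25.symm)

/-! ### Classification of the finite orbits -/

theorem finite_setOf_equivalent (t : admissibleNonFlat) : {s : admissibleNonFlat | s ≈ t}.Finite := by
  refine Set.Finite.of_finite_image (f := Subtype.val) ?_ Subtype.val_injective.injOn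
  obtain ⟨⟨x, y, z⟩, ht⟩ := t
  refine (Set.toFinite {⟨x, y, z⟩, ⟨-x, -y, z⟩, ⟨-x, y, -z⟩, ⟨x, -y, -z⟩}).subset ?_
  rintro _ ⟨s, hs, rfl⟩
  exact hs

/-- Taking all triples with class in the orbit absorbs the signs by which the braid moves differ
from the shift and the Vieta moves. The set stays finite because each class has at most four
members. -/
theorem finiteStable {t : admissibleNonFlat}
    (ht : (MulAction.orbit B₃ (Quotient.mk equivalentSetoid t)).Finite) :
    FiniteStable {p : ℂ × ℂ × ℂ | ∃ s : admissibleNonFlat, (s : Triple) = ⟨p.1, p.2.1, p.2.2⟩ ∧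
      Quotient.mk equivalentSetoid s ∈ MulAction.orbit B₃ (Quotient.mk equivalentSetoid t)} := by
  have move : ∀ (g : B₃) (s : admissibleNonFlat) (u : Triple),
      Quotient.mk equivalentSetoid s ∈ MulAction.orbit B₃ (Quotient.mk equivalentSetoid t) →
      u.Equivalent (g • (s : Triple)) → ∃ s' : admissibleNonFlat, (s' : Triple) = u ∧
      Quotient.mk equivalentSetoid s' ∈ MulAction.orbit B₃ (Quotient.mk equivalentSetoid t) := by
    intro g s u hs hu
    have hgs := (g • s).2
    have hmem : u ∈ admissibleNonFlat := by
      have hgs' : (g • (s : Triple)).Admissible ∧ (g • (s : Triple)).NonFlat := hgs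
      show u.Admissible ∧ u.NonFlat
      generalize g • (s : Triple) = v at hu hgs'
      rcases hu with rfl | rfl | rfl | rfl
      · exact hgs'
      all_goals simpa [Triple.Admissible, Triple.NonFlat] using hgs'
    refine ⟨⟨u, hmem⟩, rfl, ?_⟩
    have : Quotient.mk equivalentSetoid ⟨u, hmem⟩ = g • Quotient.mk equivalentSetoid s :=
      Quotient.sound hu
    rw [this]
    exact MulAction.mem_orbit_of_mem_orbit g hs
  refine ⟨?_, ?_, ?_, ?_, ?_, ?_⟩
  · have hfin : (Quotient.mk equivalentSetoid ⁻¹'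
        MulAction.orbit B₃ (Quotient.mk equivalentSetoid t)).Finite :=
      ht.preimage' fun b _ => by
        induction b using Quotient.inductionOn with
        | h b => exact (finite_setOf_equivalent b).subset fun s hs => Quotient.exact hs
    refine (hfin.image fun s : admissibleNonFlat => ((s : Triple).x₁, (s : Triple).x₂, (s : Triple).x₃)).subset ?_
    rintro ⟨x, y, z⟩ ⟨s, hs, hso⟩
    exact ⟨s, hso, by simp [hs]⟩
  · rintro x y z ⟨s, hs, hso⟩
    refine move (PresentedGroup.of 0 * PresentedGroup.of 1) s _ hso ?_
    rw [mul_smul, of_zero_smul_eq, of_one_smul_eq, hs]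
    -- `β₁β₂` sends `(x, y, z)` to `(-z, x, -y)`.
    exact Or.inr (Or.inr (Or.inl (by ext <;> simp [beta₁, beta₂]; ring)))
  · rintro x y z ⟨s, hs, hso⟩
    refine move (PresentedGroup.of 0) s _ hso ?_
    rw [of_zero_smul_eq, hs]
    simp [beta₁, Triple.Equivalent]
  · rintro x y z ⟨s, hs, hso⟩
    refine move (PresentedGroup.of 0)⁻¹ s _ hso ?_
    rw [show (PresentedGroup.of 0 : B₃)⁻¹ • (s : Triple) = beta₁.symm s by
      rw [inv_smul_eq_iff, of_zero_smul_eq, Equiv.apply_symm_apply], hs]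
    simp [beta₁, Triple.Equivalent]
  · rintro x y z ⟨s, hs, -⟩
    have := s.2.1.2.2
    rwa [hs] at this
  · rintro x y z ⟨s, hs, -⟩
    have := s.2.2
    rwa [hs] at this

/-- A triple whose class has a finite orbit is in the orbit of a representative. -/
theorem exists_mem_orbit_basePoint {t : admissibleNonFlat}
    (ht : (MulAction.orbit B₃ (Quotient.mk equivalentSetoid t)).Finite) :
    ∃ i, t ∈ MulAction.orbit B₃ (basePoint i) := by
  have hT := finiteStable ht
  -- Every triple of the orbit lies in the stable set, so `sq_eq` applies to each coordinate, the
  -- second and third being shifted into first place.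
  have hcoord : ∀ g : B₃, ∃ q : QuarticTriple, q.InCoords ∧ q.val = g • (t : Triple) := by
    intro g
    have hmem : ((g • (t : Triple)).x₁, (g • (t : Triple)).x₂, (g • (t : Triple)).x₃) ∈
        {p : ℂ × ℂ × ℂ | ∃ s : admissibleNonFlat, (s : Triple) = ⟨p.1, p.2.1, p.2.2⟩ ∧
        Quotient.mk equivalentSetoid s ∈ MulAction.orbit B₃ (Quotient.mk equivalentSetoid t)} :=
      ⟨g • t, rfl, g, rfl⟩
    obtain ⟨x, hx, hx'⟩ := exists_coords_of_sq (hT.sq_eq hmem)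
    obtain ⟨y, hy, hy'⟩ := exists_coords_of_sq (hT.sq_eq (hT.shift (hT.shift hmem)))
    obtain ⟨z, hz, hz'⟩ := exists_coords_of_sq (hT.sq_eq (hT.shift hmem))
    exact ⟨⟨x, y, z⟩, ⟨hx, hy, hz⟩, Triple.ext hx' hy' hz'⟩
  obtain ⟨q, hq, hqt⟩ := hcoord 1
  rw [one_smul] at hqt
  have stay : ∀ (g : B₃) (r : QuarticTriple), r.val = g • q.val → r.InCoords := fun g r hr => by
    obtain ⟨r', hr', h⟩ := hcoord g
    rw [← hqt, ← hr] at h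
    exact val_injective h ▸ hr'
  have hstays : q.Stays := by
    refine ⟨stay (PresentedGroup.of 0) _ ?_, stay (PresentedGroup.of 1) _ ?_,
      stay (PresentedGroup.of 0 * PresentedGroup.of 0) _ ?_,
      stay (PresentedGroup.of 0 * PresentedGroup.of 1) _ ?_,
      stay (PresentedGroup.of 1 * PresentedGroup.of 0) _ ?_,
      stay (PresentedGroup.of 1 * PresentedGroup.of 1) _ ?_⟩ <;>
    simp only [val_braid₁, val_braid₂, mul_smul, of_zero_smul_eq, of_one_smul_eq]
  have h0 : q.AtMostOneZero := val_admissible_iff.1 (hqt ▸ t.2.1)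
  have h4 : q.form ≠ ⟨4, 0, 0, 0⟩ := val_nonFlat_iff.1 (hqt ▸ t.2.2)
  obtain ⟨i, hi⟩ := exists_mem_orbitList _ hq.1 _ hq.2.1 _ hq.2.2 hstays h0 h4
  exact ⟨i, mem_orbit_basePoint_iff.2 ⟨q, hi, hqt⟩⟩

theorem finite_orbit_basePoint (i : Fin 5) : (MulAction.orbit B₃ (basePoint i)).Finite := by
  refine Set.Finite.of_finite_image (f := Subtype.val) ?_ Subtype.val_injective.injOn
  refine ((orbitList i).finite_toSet.image val).subset ?_
  rintro _ ⟨t, ht, rfl⟩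
  obtain ⟨q, hq, h⟩ := mem_orbit_basePoint_iff.1 ht
  exact ⟨q, hq, h⟩

theorem orbit_mk (t : admissibleNonFlat) :
    MulAction.orbit B₃ (Quotient.mk equivalentSetoid t) =
      Quotient.mk equivalentSetoid '' MulAction.orbit B₃ t := by
  ext c
  constructor
  · rintro ⟨g, rfl⟩
    exact ⟨g • t, ⟨g, rfl⟩, rfl⟩
  · rintro ⟨_, ⟨g, rfl⟩, rfl⟩
    exact ⟨g, rfl⟩

theorem not_mk_mem_orbit {i j : Fin 5} (hij : i ≠ j) : Quotient.mk equivalentSetoid (basePoint i) ∉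
    MulAction.orbit B₃ (Quotient.mk equivalentSetoid (basePoint j)) := by
  rw [orbit_mk]
  rintro ⟨t, ht, h⟩
  obtain ⟨q, hq, hqt⟩ := mem_orbit_basePoint_iff.1 ht
  have he : (t : Triple).Equivalent (basePoint i) := Quotient.exact h
  rw [← hqt] at he
  exact notMem_equivalents_base j i hij.symm q hq (val_equivalent_iff.1 he)

theorem injective_orbit_mk : Function.Injective fun i : Fin 5 =>
    MulAction.orbit B₃ (Quotient.mk equivalentSetoid (basePoint i)) := by
  intro i j h
  by_contra hij
  exact not_mk_mem_orbit hij (MulAction.orbit_eq_iff.1 h)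

theorem injective_orbit : Function.Injective fun i : Fin 5 => MulAction.orbit B₃ (basePoint i) :=
  fun i j h => injective_orbit_mk (by
    simp only [orbit_mk]
    exact congrArg _ h)

theorem finiteOrbits_triples : finiteOrbits B₃ admissibleNonFlat =
    Set.range fun i => MulAction.orbit B₃ (basePoint i) := by
  ext O
  constructor
  · rintro ⟨hO, t, rfl⟩
    -- A finite orbit of triples maps onto a finite orbit of classes, so the classification of the
    -- latter covers both.
    obtain ⟨i, hi⟩ := exists_mem_orbit_basePoint (t := t) (by rw [orbit_mk]; exact hO.image _)
    exact ⟨i, (MulAction.orbit_eq_iff.2 hi).symm⟩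
  · rintro ⟨i, rfl⟩
    exact ⟨finite_orbit_basePoint i, _, rfl⟩

theorem finiteOrbits_classes : finiteOrbits B₃ TripleClass =
    Set.range fun i => MulAction.orbit B₃ (Quotient.mk equivalentSetoid (basePoint i)) := by
  ext O
  constructor
  · rintro ⟨hO, c, rfl⟩
    induction c using Quotient.inductionOn with
    | h t =>
      obtain ⟨i, hi⟩ := exists_mem_orbit_basePoint hO
      refine ⟨i, ?_⟩
      simp only [orbit_mk]
      rw [MulAction.orbit_eq_iff.2 hi]
  · rintro ⟨i, rfl⟩
    exact ⟨by simp only [orbit_mk]; exact (finite_orbit_basePoint i).image _, _, rfl⟩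

/-! ### Lengths of the orbits -/

theorem ncard_orbit_mk (i : Fin 5) :
    (MulAction.orbit B₃ (Quotient.mk equivalentSetoid (basePoint i))).ncard =
      (![4, 9, 10, 10, 18] : Fin 5 → ℕ) i := by
  have hmem : ∀ q ∈ classList i, q.val ∈ admissibleNonFlat := fun q hq => by
    obtain ⟨g, h⟩ := mem_orbit_base_iff.2 ⟨q, mem_orbitList_of_mem_classList i q hq, rfl⟩
    rw [← show _ = _ from h]
    exact (g • basePoint i).2
  have hnodup : (classList i).Nodup := (pairwise_classList i).imp fun {s t} h => by
    rintro rfl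
    exact h (by simp [equivalents])
  have hset : MulAction.orbit B₃ (Quotient.mk equivalentSetoid (basePoint i)) =
      Set.range fun q : {q // q ∈ (classList i).toFinset} =>
        Quotient.mk equivalentSetoid ⟨q.1.val, hmem q.1 (List.mem_toFinset.1 q.2)⟩ := by
    rw [orbit_mk]
    ext c
    constructor
    · rintro ⟨t, ht, rfl⟩
      obtain ⟨q, hq, hqt⟩ := mem_orbit_basePoint_iff.1 ht
      obtain ⟨s, hs, hsq⟩ := exists_mem_classList i q hq
      refine ⟨⟨s, List.mem_toFinset.2 hs⟩, Quotient.sound ?_⟩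
      change s.val.Equivalent t
      rw [← hqt]
      exact val_equivalent_iff.2 hsq
    · rintro ⟨⟨q, hq⟩, rfl⟩
      have hq' := List.mem_toFinset.1 hq
      exact ⟨_, mem_orbit_basePoint_iff.2 ⟨q, mem_orbitList_of_mem_classList i q hq', rfl⟩, rfl⟩
  rw [hset, ← Set.image_univ, Set.ncard_image_of_injective, Set.ncard_univ, Nat.card_eq_fintype_card,
    Fintype.card_coe, List.toFinset_card_of_nodup hnodup, length_classList]
  rintro ⟨s, hs⟩ ⟨t, ht⟩ h
  have he : s ∈ t.equivalents := val_equivalent_iff.1 (Quotient.exact h)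
  have he' : t ∈ s.equivalents := val_equivalent_iff.1 (Quotient.exact h.symm)
  by_contra hne
  have hne' : s ≠ t := fun h => hne (Subtype.ext h)
  -- `Pairwise` compares only in list order; symmetrising the relation makes it available for any
  -- two distinct members.
  have hsymm : (classList i).Pairwise fun s t => s ∉ t.equivalents ∨ t ∉ s.equivalents :=
    (pairwise_classList i).imp Or.inl
  have : Std.Symm fun s t : QuarticTriple => s ∉ t.equivalents ∨ t ∉ s.equivalents :=
    ⟨fun _ _ => Or.symm⟩
  rcases hsymm.forall (List.mem_toFinset.1 hs) (List.mem_toFinset.1 ht) hne'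
    with h | h
  exacts [h he, h he']

theorem ncard_range_of_injective {α : Type*} {f : Fin 5 → α} (hf : Function.Injective f) :
    (Set.range f).ncard = 5 := by
  rw [← Set.image_univ, Set.ncard_image_of_injective _ hf, Set.ncard_univ, Nat.card_fin]

end QuarticTriple

end BraidTriples
open BraidTriples in
theorem corollary1p3 :
    -- there are exactly five finite orbits of triples, and of equivalence classes of triples
    (finiteOrbits B₃ admissibleNonFlat).ncard = 5 ∧
    (finiteOrbits B₃ TripleClass).ncard = 5 ∧
    -- they are the orbits of the five representatives, with the stated lengths
    ∃ P : Fin 5 → admissibleNonFlat,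
      (∀ i, (P i : Triple) = representative i) ∧
      finiteOrbits B₃ admissibleNonFlat = Set.range (fun i => MulAction.orbit B₃ (P i)) ∧
      finiteOrbits B₃ TripleClass =
        Set.range (fun i => MulAction.orbit B₃ (Quotient.mk equivalentSetoid (P i))) ∧
      ∀ i, (MulAction.orbit B₃ (Quotient.mk equivalentSetoid (P i))).ncard =
        (![4, 9, 10, 10, 18] : Fin 5 → ℕ) i := by
  refine ⟨?_, ?_, QuarticTriple.basePoint, QuarticTriple.val_base,
    QuarticTriple.finiteOrbits_triples, QuarticTriple.finiteOrbits_classes,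
    QuarticTriple.ncard_orbit_mk⟩
  · rw [QuarticTriple.finiteOrbits_triples]
    exact QuarticTriple.ncard_range_of_injective QuarticTriple.injective_orbit
  · rw [QuarticTriple.finiteOrbits_classes]
    exact QuarticTriple.ncard_range_of_injective QuarticTriple.injective_orbit_mk
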